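/- Let $V$ be a finite-dimensional real vector space with a Lorentzian form $\ell$ of signature $(+,-,\dots,-)$, and let $C$ be one of the two closed convex round cones whose union is $\{v\in V:\ell(v,v)\ge 0\}$. Let $\Gamma$ be a group of affine transformations $\gamma(v)=\lambda(\gamma)v+\tau(\gamma)$ of $V$ which acts freely and properly on $V$ (as a discrete group) and whose linear parts $\lambda(\gamma)$ preserve $\ell$ and $C$. Put $G=\lambda(\Gamma)$, let $\kappa:V\to M=V/\Gamma$ be the quotient map, and for $p=\kappa(v)\in M$ define the future $F_p=\kappa(v+C)$ and the past $P_p=\kappa(v-C)$. A piecewise smooth path in $M$ is called timelike if its velocity at each of its points $\kappa(v)$ lies in the closed cone $d_v\kappa(C)$. $M$ is called causal if it admits no nonconstant closed piecewise smooth timelike path, and strictly causal if, moreover, each $p\in M$ has a neighbourhood $U$ such that $U\cap F_p$ and $U\cap P_p$ are closed in $U$. $M$ is called elliptic if $G$ has a fixed vector in the interior of $C$. Proposition. If $M$ is strictly causal and not elliptic, then there is a nonzero $G$-fixed vector $v_0\in\partial C$, and for every such $v_0$ $$\tau(\gamma)\in W:=v_0^{\perp}=\{w\in V:\ell(w,v_0)=0\}\qquad\text{for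 all }\gamma\in\Gamma .$$ -/

import Mathlib

open Set Filter Topology
open scoped ContDiff

namespace FlatLorentz

section Form

variable {V : Type*} [AddCommGroup V] [Module ℝ V]

/-- `ℓ` is a Lorentzian form on `V`, i.e. a symmetric bilinear form of signature `(+,-,…,-)`:
in a suitable basis `b 0, …, b n` it is `x₀y₀ - x₁y₁ - … - xₙyₙ`. -/
def IsLorentzian (ℓ : LinearMap.BilinForm ℝ V) : Prop :=
  ∃ (n : ℕ) (b : Module.Basis (Fin (n + 1)) ℝ V), ∀ i j,
    ℓ (b i) (b j) = if i = j then (if i = 0 then 1 else -1) else 0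

/-- The closed convex round cone containing the vector `e`, for `e` with `ℓ(e,e) > 0`: one of the
two cones whose union is `{v | ℓ(v,v) ≥ 0}` (the other one is the cone of `-e`). -/
def cone (ℓ : LinearMap.BilinForm ℝ V) (e : V) : Set V :=
  {v | 0 ≤ ℓ v v ∧ 0 ≤ ℓ e v}

/-- The subspace `W = v₀^⊥` (the orthogonal complement of the line `L = ℝ v₀`). -/
def perp (ℓ : LinearMap.BilinForm ℝ V) (v₀ : V) : Submodule ℝ V :=
  ℓ.orthogonal (Submodule.span ℝ {v₀})

end Form

section Quotient

variable {V : Type*} [NormedAddCommGroup V] [NormedSpace ℝ V]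

/-- The standing assumptions on the group `Γ` of affine transformations of `V`: linear parts keep
the form `ℓ` and the cone `C`, and the action on `V` is free and proper. -/
structure IsAdmissible (ℓ : LinearMap.BilinForm ℝ V) (C : Set V)
    (Γ : Subgroup (V ≃ᵃ[ℝ] V)) : Prop where
  form_eq : ∀ γ ∈ Γ, ∀ u v, ℓ (γ.linear u) (γ.linear v) = ℓ u v
  image_cone : ∀ γ ∈ Γ, γ.linear '' C = C
  free : ∀ γ ∈ Γ, ∀ v, γ v = v → γ = 1
  proper : ∀ K : Set V, IsCompact K → {γ | γ ∈ Γ ∧ (γ '' K ∩ K).Nonempty}.Finite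

/-- The equivalence relation on `V` whose classes are the orbits of `Γ`. -/
def orbitSetoid (Γ : Subgroup (V ≃ᵃ[ℝ] V)) : Setoid V where
  r v w := ∃ γ ∈ Γ, γ v = w
  iseqv :=
    { refl := fun _ => ⟨1, Γ.one_mem, rfl⟩
      symm := by
        rintro v w ⟨γ, hγ, rfl⟩
        exact ⟨γ⁻¹, Γ.inv_mem hγ, γ.symm_apply_apply v⟩
      trans := by
        rintro u v w ⟨γ, hγ, rfl⟩ ⟨δ, hδ, rfl⟩
        exact ⟨δ * γ, Γ.mul_mem hδ hγ, rfl⟩ }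

/-- The space `M = V/Γ`, with the quotient topology. -/
abbrev Manifold (Γ : Subgroup (V ≃ᵃ[ℝ] V)) : Type _ := Quotient (orbitSetoid Γ)

/-- The quotient mapping `κ : V → M`. -/
def proj (Γ : Subgroup (V ≃ᵃ[ℝ] V)) (v : V) : Manifold Γ := Quotient.mk (orbitSetoid Γ) v

/-- The future `F_p = κ(v + C)`, `κ(v) = p`. -/
def future (C : Set V) (Γ : Subgroup (V ≃ᵃ[ℝ] V)) (p : Manifold Γ) : Set (Manifold Γ) :=
  {q | ∃ v, proj Γ v = p ∧ ∃ c ∈ C, proj Γ (v + c) = q}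

/-- The past `P_p = κ(v - C)`, `κ(v) = p`. -/
def past (C : Set V) (Γ : Subgroup (V ≃ᵃ[ℝ] V)) (p : Manifold Γ) : Set (Manifold Γ) :=
  {q | ∃ v, proj Γ v = p ∧ ∃ c ∈ C, proj Γ (v - c) = q}

/-- The path `η` in `M` is smooth and timelike on the segment `[a, b]`. The smooth structure of
`M` is the one for which `κ` is a local diffeomorphism, and the cone of `M` at `κ(v)` is
`d_vκ(C)`: near each `t ∈ [a, b]` the path is `κ ∘ c` for a smooth path `c` in `V` and
`c'(t) ∈ C`. -/
def IsSmoothTimelikeOn (C : Set V) (Γ : Subgroup (V ≃ᵃ[ℝ] V)) (η : ℝ → Manifold Γ)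
    (a b : ℝ) : Prop :=
  ∀ t ∈ Icc a b, ∃ c : ℝ → V, ContDiff ℝ ∞ c ∧
    (∀ᶠ s in 𝓝[Icc a b] t, η s = proj Γ (c s)) ∧ deriv c t ∈ C

/-- The path `η : [0, 1] → M` is piecewise smooth and timelike. -/
def IsTimelikePath (C : Set V) (Γ : Subgroup (V ≃ᵃ[ℝ] V)) {p q : Manifold Γ}
    (η : Path p q) : Prop :=
  ∃ (k : ℕ) (t : ℕ → ℝ), t 0 = 0 ∧ t k = 1 ∧
    ∀ i < k, t i < t (i + 1) ∧ IsSmoothTimelikeOn C Γ η.extend (t i) (t (i + 1))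

/-- `M` is causal: it admits no closed piecewise smooth timelike paths, except for the constant
ones (zero velocity belongs to the closed cone, so constant paths satisfy `IsTimelikePath`). -/
def IsCausal (C : Set V) (Γ : Subgroup (V ≃ᵃ[ℝ] V)) : Prop :=
  ∀ (p : Manifold Γ) (η : Path p p), IsTimelikePath C Γ η → ∀ s, η s = p

/-- `M` is strictly causal: it is causal and each `p ∈ M` has a neighbourhood `U` such that
`U ∩ F_p` and `U ∩ P_p` are closed in `U`. -/
def IsStrictlyCausal (C : Set V) (Γ : Subgroup (V ≃ᵃ[ℝ] V)) : Prop :=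
  IsCausal C Γ ∧ ∀ p : Manifold Γ, ∃ U ∈ 𝓝 p,
    IsClosed ((↑) ⁻¹' future C Γ p : Set U) ∧ IsClosed ((↑) ⁻¹' past C Γ p : Set U)

/-- `v` is fixed by the group `G = λ(Γ)` of linear parts. -/
def IsFixed (Γ : Subgroup (V ≃ᵃ[ℝ] V)) (v : V) : Prop :=
  ∀ γ ∈ Γ, γ.linear v = v

/-- `M` (or `Γ`, or `G`) is elliptic: `G` has a fixed vector in the interior of the cone. -/
def IsElliptic (C : Set V) (Γ : Subgroup (V ≃ᵃ[ℝ] V)) : Prop :=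
  ∃ v ∈ interior C, IsFixed Γ v

/-- The translation part `τ(γ)` in `γ(v) = λ(γ)v + τ(γ)`. -/
def trans (γ : V ≃ᵃ[ℝ] V) : V := γ 0

end Quotient

end FlatLorentz

/-! In a causal quotient every nontrivial `γ` displaces each point by a spacelike vector: a segment
from `v` to `γ v` with direction in the cone projects to a nonconstant closed timelike path. Both
conclusions rest on this.

Fixed vector. For such `γ` the range of `λ(γ) - 1` has no timelike vector, so its orthogonal
complement, the fixed space of `λ(γ)`, contains a nonzero cone vector (`exists_fixed_mem_cone`). If
the `G`-orbit of `e` is bounded, maximizing `ℓ z z` over its closed convex hull gives a fixed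
interior vector, the elliptic case. Otherwise rescaled linear parts converge to some `T ≠ 0` with
isotropic values; the line of `T e` is `G`-invariant, and the individual fixed vectors exclude
scaling (`exists_isFixed_of_unbounded`).

Translations. If `ℓ v₀ (γ 0) ≠ 0`, then `γ` translates an axis through some `o` by a `λ(γ)`-fixed
`q` (`exists_axis`) with `ℓ q v₀ ≠ 0`. Non-ellipticity yields `δ` making `λ(δ) q + q` timelike
(`exists_lt_form_linear`). Then `γ ^ k * δ * γ ^ k` moves `o` by a timelike vector for large `k`, a
contradiction. -/

namespace FlatLorentz

/-! ### Algebra of Lorentzian forms and isometries -/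

section LorentzianAlgebra

variable {V : Type*} [AddCommGroup V] [Module ℝ V]

/-- The properties of a Lorentzian form `ℓ` and a timelike vector `e` from which the geometry of
the cone of `e` is derived: the orthogonal complement of a timelike vector is negative definite. -/
structure IsTimeOriented (ℓ : LinearMap.BilinForm ℝ V) (e : V) : Prop where
  symm : ∀ x y, ℓ x y = ℓ y x
  neg : ∀ u x, 0 < ℓ u u → ℓ u x = 0 → x ≠ 0 → ℓ x x < 0
  pos : 0 < ℓ e e

theorem IsLorentzian.isTimeOriented {ℓ : LinearMap.BilinForm ℝ V} (h : IsLorentzian ℓ) {e : V}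
    (he : 0 < ℓ e e) : IsTimeOriented ℓ e := by
  obtain ⟨n, b, hb⟩ := h
  have key : ∀ x y, ℓ x y = b.repr x 0 * b.repr y 0
      - ∑ i : Fin n, b.repr x i.succ * b.repr y i.succ := by
    intro x y
    conv_lhs => rw [← b.sum_repr x, ← b.sum_repr y]
    simp only [map_sum, LinearMap.sum_apply, map_smul, LinearMap.smul_apply, hb, smul_eq_mul,
      mul_ite, mul_zero]
    rw [Fin.sum_univ_succ, sub_eq_add_neg, ← Finset.sum_neg_distrib]
    congr 1
    · simp [mul_comm]
    · refine Finset.sum_congr rfl fun i _ => ?_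
      simp [Fin.succ_ne_zero, mul_comm]
  refine ⟨fun x y => ?_, fun u x hu hux hx => ?_, he⟩
  · rw [key, key]
    simp only [mul_comm]
  · rw [key] at hu hux ⊢
    -- Cauchy–Schwarz on the spacelike coordinates; orthogonality turns the sum of products into the
    -- product of the time coordinates.
    have hCS := Finset.sum_mul_sq_le_sq_mul_sq Finset.univ
      (fun i : Fin n => b.repr u i.succ) (fun i : Fin n => b.repr x i.succ)
    simp only [← sq] at hu ⊢
    set S := ∑ i : Fin n, b.repr u i.succ ^ 2 with hS
    set T := ∑ i : Fin n, b.repr x i.succ ^ 2 with hT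
    have hS0 : 0 ≤ S := Finset.sum_nonneg fun i _ => sq_nonneg _
    have hT0 : 0 ≤ T := Finset.sum_nonneg fun i _ => sq_nonneg _
    have hux' := sub_eq_zero.mp hux
    rw [← hux', mul_pow] at hCS
    have hu0 : 0 < b.repr u 0 ^ 2 := by linarith
    rcases hT0.eq_or_lt with hT1 | hT1
    · exfalso
      apply hx
      have h0 : b.repr x 0 = 0 := by
        rw [← hT1, mul_zero] at hCS
        have h1 : b.repr x 0 ^ 2 ≤ 0 := by
          by_contra! h2
          exact absurd hCS (not_le.mpr (mul_pos hu0 h2))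
        exact pow_eq_zero_iff two_ne_zero |>.mp (le_antisymm h1 (sq_nonneg _))
      have h1 := (Finset.sum_eq_zero_iff_of_nonneg fun i _ => sq_nonneg _).mp hT1.symm
      apply b.repr.map_eq_zero_iff.mp
      ext i
      refine Fin.cases ?_ (fun j => ?_) i
      · simpa using h0
      · simpa using h1 j (Finset.mem_univ j)
    · have h1 : b.repr u 0 ^ 2 * b.repr x 0 ^ 2 < b.repr u 0 ^ 2 * T :=
        lt_of_le_of_lt hCS (mul_lt_mul_of_pos_right (by linarith) hT1)
      have := lt_of_mul_lt_mul_left h1 hu0.le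
      linarith

variable {ℓ : LinearMap.BilinForm ℝ V} {e : V}

theorem form_add_smul (hs : ∀ x y, ℓ x y = ℓ y x) (x y : V) (t : ℝ) :
    ℓ (x + t • y) (x + t • y) = ℓ x x + 2 * t * ℓ x y + t ^ 2 * ℓ y y := by
  simp only [map_add, LinearMap.add_apply, map_smul, LinearMap.smul_apply, smul_eq_mul, hs y x]
  ring

/-- The quadratic in `k` has positive leading coefficient. An integer is needed because `k` later
becomes an exponent. -/
theorem exists_nat_form_add_smul_pos (hs : ∀ x y, ℓ x y = ℓ y x) (x : V) {y : V}
    (hy : 0 < ℓ y y) : ∃ k : ℕ, 0 < ℓ (x + (k : ℝ) • y) (x + (k : ℝ) • y) := by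
  obtain ⟨t, ht⟩ := exists_nat_gt ((|ℓ x x| + 2 * |ℓ x y|) / ℓ y y + 1)
  refine ⟨t, ?_⟩
  rw [form_add_smul hs]
  have h0 : 0 ≤ (|ℓ x x| + 2 * |ℓ x y|) / ℓ y y := by positivity
  have h2 : |ℓ x x| + 2 * |ℓ x y| < t * ℓ y y := by
    rw [← div_lt_iff₀ hy]
    linarith
  have ht1 : (1 : ℝ) ≤ t := by linarith
  have h3 : (t : ℝ) * (|ℓ x x| + 2 * |ℓ x y|) < t * (t * ℓ y y) :=
    mul_lt_mul_of_pos_left h2 (by linarith)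
  have h4 : |ℓ x x| ≤ t * |ℓ x x| := le_mul_of_one_le_left (abs_nonneg _) ht1
  have h5 := neg_abs_le (ℓ x x)
  have h6 : (t : ℝ) * -|ℓ x y| ≤ t * ℓ x y :=
    mul_le_mul_of_nonneg_left (neg_abs_le _) (by linarith)
  linarith

namespace IsTimeOriented

variable (h : IsTimeOriented ℓ e)
include h

theorem eq_zero_of_orthogonal {u x : V} (hu : 0 < ℓ u u) (hux : ℓ u x = 0) (hx : 0 ≤ ℓ x x) :
    x = 0 := by
  by_contra h0
  exact absurd (h.neg u x hu hux h0) (not_lt.mpr hx)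

theorem nondegenerate : ℓ.Nondegenerate := by
  constructor
  · intro x hx
    exact h.eq_zero_of_orthogonal h.pos (by rw [h.symm, hx]) (hx x).ge
  · intro x hx
    exact h.eq_zero_of_orthogonal h.pos (hx e) (hx x).ge

theorem isRefl : LinearMap.BilinForm.IsRefl ℓ := fun x y hxy => by rw [h.symm, hxy]

theorem self_mem_cone : e ∈ cone ℓ e := ⟨h.pos.le, h.pos.le⟩

theorem ne_zero : e ≠ 0 := by
  rintro rfl
  simpa using h.pos

theorem time_pos {x : V} (hx : x ∈ cone ℓ e) (h0 : x ≠ 0) : 0 < ℓ e x :=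
  lt_of_le_of_ne hx.2 fun hx0 => h0 (h.eq_zero_of_orthogonal h.pos hx0.symm hx.1)

/-- The inequality behind all the properties of the cone. -/
theorem time_mul_le (x y : V) :
    ℓ e y ^ 2 * ℓ x x + ℓ e x ^ 2 * ℓ y y ≤ 2 * (ℓ e x * ℓ e y) * ℓ x y ∧
    (ℓ e y ^ 2 * ℓ x x + ℓ e x ^ 2 * ℓ y y = 2 * (ℓ e x * ℓ e y) * ℓ x y →
      ℓ e y • x = ℓ e x • y) := by
  -- This combination lies in the negative definite complement of `e`; its square gives the
  -- inequality, and vanishes only when the combination does.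
  have h1 : ℓ e (ℓ e y • x - ℓ e x • y) = 0 := by
    simp only [map_sub, map_smul, smul_eq_mul]
    ring
  have h2 : ℓ (ℓ e y • x - ℓ e x • y) (ℓ e y • x - ℓ e x • y)
      = ℓ e y ^ 2 * ℓ x x + ℓ e x ^ 2 * ℓ y y - 2 * (ℓ e x * ℓ e y) * ℓ x y := by
    simp only [map_sub, map_smul, smul_eq_mul, LinearMap.sub_apply, LinearMap.smul_apply,
      h.symm y x]
    ring
  constructor
  · by_contra! h3
    have h4 := h.eq_zero_of_orthogonal h.pos h1 (by rw [h2]; linarith)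
    rw [h4] at h2
    simp only [map_zero] at h2
    linarith
  · intro h3
    exact sub_eq_zero.mp (h.eq_zero_of_orthogonal h.pos h1 (by rw [h2]; linarith))

theorem cone_nonneg {x y : V} (hx : x ∈ cone ℓ e) (hy : y ∈ cone ℓ e) : 0 ≤ ℓ x y := by
  by_cases hx0 : x = 0
  · simp [hx0]
  by_cases hy0 : y = 0
  · simp [hy0]
  have hp := mul_pos (h.time_pos hx hx0) (h.time_pos hy hy0)
  have h1 := (h.time_mul_le x y).1
  have h2 := mul_nonneg (sq_nonneg (ℓ e y)) hx.1
  have h3 := mul_nonneg (sq_nonneg (ℓ e x)) hy.1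
  by_contra! h4
  have := mul_neg_of_pos_of_neg hp h4
  linarith

/-- Equality case of `time_mul_le`: orthogonal cone vectors are parallel. -/
theorem smul_eq_of_orthogonal {x y : V} (hx : x ∈ cone ℓ e) (hy : y ∈ cone ℓ e)
    (hxy : ℓ x y = 0) : ℓ e y • x = ℓ e x • y := by
  apply (h.time_mul_le x y).2
  have h1 := (h.time_mul_le x y).1
  have h2 := mul_nonneg (sq_nonneg (ℓ e y)) hx.1
  have h3 := mul_nonneg (sq_nonneg (ℓ e x)) hy.1
  rw [hxy] at *
  linarith

theorem cone_pos {x y : V} (hx : x ∈ cone ℓ e) (hx' : 0 < ℓ x x) (hy : y ∈ cone ℓ e)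
    (hy0 : y ≠ 0) : 0 < ℓ x y :=
  lt_of_le_of_ne (h.cone_nonneg hx hy) fun h0 => hy0 (h.eq_zero_of_orthogonal hx' h0.symm hy.1)

theorem add_mem_cone {x y : V} (hx : x ∈ cone ℓ e) (hy : y ∈ cone ℓ e) : x + y ∈ cone ℓ e := by
  refine ⟨?_, ?_⟩
  · have := h.cone_nonneg hx hy
    have h1 := hx.1
    have h2 := hy.1
    simp only [map_add, LinearMap.add_apply, h.symm y x]
    linarith
  · rw [map_add]
    exact add_nonneg hx.2 hy.2

omit h in
theorem smul_mem_cone {x : V} (hx : x ∈ cone ℓ e) {t : ℝ} (ht : 0 ≤ t) : t • x ∈ cone ℓ e := by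
  refine ⟨?_, ?_⟩
  · simp only [map_smul, LinearMap.smul_apply, smul_eq_mul]
    exact mul_nonneg ht (mul_nonneg ht hx.1)
  · rw [map_smul]
    exact mul_nonneg ht hx.2

theorem convex_cone : Convex ℝ (cone ℓ e) := fun _ hx _ hy _ _ ha hb _ =>
  h.add_mem_cone (smul_mem_cone hx ha) (smul_mem_cone hy hb)

theorem eq_zero_of_neg_mem {x : V} (hx : x ∈ cone ℓ e) (hx' : -x ∈ cone ℓ e) : x = 0 := by
  by_contra h0
  have h1 := h.time_pos hx h0
  have h2 := hx'.2
  rw [map_neg] at h2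
  linarith

omit h in
theorem mem_cone_or_neg_mem {x : V} (hx : 0 ≤ ℓ x x) : x ∈ cone ℓ e ∨ -x ∈ cone ℓ e := by
  rcases le_total 0 (ℓ e x) with h1 | h1
  · exact Or.inl ⟨hx, h1⟩
  · exact Or.inr ⟨by simpa using hx, by simpa using h1⟩

/-- The orthogonal complement of a subspace without timelike vectors contains a nonzero vector of
the cone. -/
theorem exists_mem_cone_orthogonal [FiniteDimensional ℝ V] (R : Submodule ℝ V)
    (hR : ∀ x ∈ R, ℓ x x ≤ 0) : ∃ w ∈ cone ℓ e, w ≠ 0 ∧ ∀ x ∈ R, ℓ x w = 0 := by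
  suffices ∃ w, 0 ≤ ℓ w w ∧ w ≠ 0 ∧ ∀ x ∈ R, ℓ x w = 0 by
    obtain ⟨w, hw, hw0, hx⟩ := this
    rcases mem_cone_or_neg_mem (e := e) hw with h1 | h1
    · exact ⟨w, h1, hw0, hx⟩
    · exact ⟨-w, h1, neg_ne_zero.mpr hw0, fun x hxR => by rw [map_neg, hx x hxR, neg_zero]⟩
  -- If `R` is nondegenerate, the component of `e` orthogonal to `R` is timelike; otherwise the
  -- radical of `R` supplies an isotropic vector.
  by_cases hd : Disjoint R (LinearMap.BilinForm.orthogonal ℓ R)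
  · have hc := ((LinearMap.BilinForm.isCompl_orthogonal_iff_disjoint h.isRefl).mpr hd).codisjoint
    obtain ⟨r, f, hr, hf, hrf⟩ := Submodule.codisjoint_iff_exists_add_eq.mp hc e
    have hrf0 : ℓ r f = 0 := LinearMap.BilinForm.mem_orthogonal_iff.mp hf r hr
    have h1 := h.pos
    have h2 := hR r hr
    rw [← hrf] at h1
    simp only [map_add, LinearMap.add_apply, h.symm f r, hrf0] at h1
    have h3 : 0 < ℓ f f := by linarith
    refine ⟨f, h3.le, ?_, fun x hx => LinearMap.BilinForm.mem_orthogonal_iff.mp hf x hx⟩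
    rintro rfl
    simp at h3
  · rw [Submodule.disjoint_def] at hd
    push Not at hd
    obtain ⟨x, hx, hx', hx0⟩ := hd
    have hx'' := LinearMap.BilinForm.mem_orthogonal_iff.mp hx'
    exact ⟨x, (hx'' x hx).ge, hx0, hx''⟩

/-- If `x ↦ g x + τ` displaces no point by a causal vector, then `g` fixes a nonzero vector of the
cone. -/
theorem exists_fixed_mem_cone [FiniteDimensional ℝ V] (g : V ≃ₗ[ℝ] V)
    (hg : ∀ u v, ℓ (g u) (g v) = ℓ u v) (τ : V)
    (hτ : ∀ v, ℓ (τ + (g v - v)) (τ + (g v - v)) < 0) :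
    ∃ w ∈ cone ℓ e, w ≠ 0 ∧ g w = w := by
  have hR : ∀ x ∈ LinearMap.range (g.toLinearMap - LinearMap.id), ℓ x x ≤ 0 := by
    rintro _ ⟨v, rfl⟩
    simp only [LinearMap.sub_apply, LinearEquiv.coe_coe, LinearMap.id_apply]
    by_contra! hpos
    obtain ⟨k, hk⟩ := exists_nat_form_add_smul_pos h.symm τ hpos
    have h1 := hτ ((k : ℝ) • v)
    rw [map_smul, ← smul_sub] at h1
    exact lt_asymm h1 hk
  obtain ⟨w, hw, hw0, hwR⟩ := h.exists_mem_cone_orthogonal _ hR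
  refine ⟨w, hw, hw0, ?_⟩
  rw [← sub_eq_zero]
  apply h.nondegenerate.2
  intro u
  obtain ⟨v, rfl⟩ := g.surjective u
  have h1 := hwR _ ⟨v, rfl⟩
  simp only [LinearMap.sub_apply, LinearEquiv.coe_coe, LinearMap.id_apply, map_sub] at h1
  rw [map_sub, hg]
  linarith

/-- If `x ↦ g x + τ` displaces no point by a causal vector, then it displaces some point by a
vector fixed by `g`. -/
theorem exists_axis [FiniteDimensional ℝ V] (g : V ≃ₗ[ℝ] V)
    (hg : ∀ u v, ℓ (g u) (g v) = ℓ u v) (τ : V)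
    (hτ : ∀ v, ℓ (τ + (g v - v)) (τ + (g v - v)) < 0) :
    ∃ o, g (τ + (g o - o)) = τ + (g o - o) := by
  set D := g.toLinearMap - LinearMap.id with hD
  have hDa : ∀ v, D v = g v - v := fun v => rfl
  set R := LinearMap.range D
  set F := LinearMap.ker D
  have hFR : F = LinearMap.BilinForm.orthogonal ℓ R := by
    ext x
    rw [LinearMap.BilinForm.mem_orthogonal_iff, LinearMap.mem_ker, hDa]
    constructor
    · rintro hx _ ⟨v, rfl⟩
      show ℓ (D v) x = 0
      rw [hDa, map_sub, LinearMap.sub_apply]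
      nth_rw 1 [← sub_eq_zero.mp hx]
      rw [hg, sub_self]
    · intro hx
      apply h.nondegenerate.2
      intro u
      obtain ⟨v, rfl⟩ := g.surjective u
      have h1 : ℓ (D v) x = 0 := hx _ ⟨v, rfl⟩
      rw [hDa, map_sub, LinearMap.sub_apply] at h1
      rw [map_sub, hg]
      linarith
  have hRF : LinearMap.BilinForm.orthogonal ℓ F = R := by
    rw [hFR, LinearMap.BilinForm.orthogonal_orthogonal h.nondegenerate h.isRefl]
  -- The complement of `F ⊔ R` is `F ⊓ R`, which is isotropic. If such an `x` had `ℓ τ x ≠ 0`, the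
  -- square of `τ + t • x` would be affine and nonconstant in `t`, hence zero for some displacement.
  have hmem : τ ∈ F ⊔ R := by
    rw [← LinearMap.BilinForm.orthogonal_orthogonal h.nondegenerate h.isRefl (F ⊔ R),
      LinearMap.BilinForm.mem_orthogonal_iff]
    intro x hx
    have hxF : x ∈ F := by
      rw [hFR]
      exact LinearMap.BilinForm.orthogonal_le le_sup_right hx
    have hxR : x ∈ R := by
      rw [← hRF]
      exact LinearMap.BilinForm.orthogonal_le le_sup_left hx
    obtain ⟨v, hv⟩ := hxR
    have hxx : ℓ x x = 0 := by
      rw [hFR] at hxF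
      exact LinearMap.BilinForm.mem_orthogonal_iff.mp hxF x ⟨v, hv⟩
    show ℓ x τ = 0
    by_contra hne
    have hne' : ℓ τ x ≠ 0 := fun h0 => hne (by rw [h.symm, h0])
    have h1 := hτ ((-ℓ τ τ / (2 * ℓ τ x)) • v)
    rw [map_smul, ← smul_sub, ← hDa, hv, form_add_smul h.symm, hxx] at h1
    have h2 : 2 * (-ℓ τ τ / (2 * ℓ τ x)) * ℓ τ x = -ℓ τ τ := by
      field_simp
    rw [h2] at h1
    linarith
  obtain ⟨f, hf, r, ⟨v, rfl⟩, hfr⟩ := Submodule.mem_sup.mp hmem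
  refine ⟨-v, ?_⟩
  have h1 : τ + (g (-v) - -v) = f := by
    rw [← hfr, hDa, map_neg]
    abel
  rw [h1]
  exact sub_eq_zero.mp hf

end IsTimeOriented

end LorentzianAlgebra

/-! ### Displacements in causal quotients -/

section Causality

variable {V : Type*} [NormedAddCommGroup V] [NormedSpace ℝ V]

theorem affineEquiv_apply (γ : V ≃ᵃ[ℝ] V) (v : V) : γ v = γ.linear v + γ 0 := by
  simpa using γ.map_vadd 0 v

theorem affineEquiv_apply_sub (γ : V ≃ᵃ[ℝ] V) (v w : V) : γ v - γ w = γ.linear (v - w) := by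
  rw [affineEquiv_apply γ v, affineEquiv_apply γ w, map_sub]
  abel

theorem affineEquiv_apply_sub_self (γ : V ≃ᵃ[ℝ] V) (v : V) :
    γ v - v = γ 0 + (γ.linear v - v) := by
  rw [affineEquiv_apply γ v]
  abel

variable {ℓ : LinearMap.BilinForm ℝ V} {e : V} {Γ : Subgroup (V ≃ᵃ[ℝ] V)} {C : Set V}

theorem IsAdmissible.linear_mem (hΓ : IsAdmissible ℓ C Γ) {γ : V ≃ᵃ[ℝ] V} (hγ : γ ∈ Γ) {x : V}
    (hx : x ∈ C) : γ.linear x ∈ C := by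
  rw [← hΓ.image_cone γ hγ]
  exact mem_image_of_mem _ hx

/-- Points of a nondegenerate segment are not all equivalent. -/
theorem IsAdmissible.exists_proj_ne (hΓ : IsAdmissible ℓ C Γ) (v : V) {x : V} (hx : x ≠ 0) :
    ∃ s ∈ Icc (0 : ℝ) 1, proj Γ (v + s • x) ≠ proj Γ v := by
  by_contra! hall
  have hex : ∀ s ∈ Icc (0 : ℝ) 1, ∃ γ ∈ Γ, γ (v + s • x) = v := fun s hs =>
    Quotient.exact (hall s hs)
  choose! δ hδ hδv using hex
  set K := (fun s : ℝ => v + s • x) '' Icc 0 1 with hK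
  have hKc : IsCompact K := isCompact_Icc.image (by fun_prop)
  have hvK : v ∈ K := ⟨0, by simp, by simp⟩
  -- Distinct parameters need distinct `δ s`, so infinitely many elements make `K` meet itself,
  -- against properness.
  refine Set.infinite_of_injOn_mapsTo (f := δ) (s := Icc (0 : ℝ) 1) ?_ ?_
    (Icc_infinite zero_lt_one) (hΓ.proper K hKc)
  · intro s hs t ht hst
    have h1 : δ s (v + s • x) = δ s (v + t • x) := by
      rw [hδv s hs, hst, hδv t ht]
    exact smul_left_injective ℝ hx (add_left_cancel ((δ s).injective h1))
  · intro s hs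
    exact ⟨hδ s hs, v, ⟨v + s • x, mem_image_of_mem _ hs, hδv s hs⟩, hvK⟩

/-- In a causal manifold no element of `Γ` moves a point into its future. -/
theorem IsAdmissible.displacement_notMem (hΓ : IsAdmissible ℓ C Γ) (hc : IsCausal C Γ)
    {γ : V ≃ᵃ[ℝ] V} (hγ : γ ∈ Γ) (hγ1 : γ ≠ 1) (v : V) : γ v - v ∉ C := by
  intro hmem
  set x := γ v - v with hx
  have hx0 : x ≠ 0 := fun h0 => hγ1 (hΓ.free γ hγ v (sub_eq_zero.mp h0))
  obtain ⟨s, hs, hne⟩ := hΓ.exists_proj_ne v hx0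
  let η : Path (proj Γ v) (proj Γ v) :=
    { toFun := fun s => proj Γ (v + (s : ℝ) • x)
      continuous_toFun := continuous_quotient_mk'.comp (by fun_prop)
      source' := by simp
      target' := by
        rw [Set.Icc.coe_one, one_smul, hx, add_sub_cancel]
        exact (Quotient.sound ⟨γ, hγ, rfl⟩ : proj Γ v = proj Γ (γ v)).symm }
  have hη : IsTimelikePath C Γ η := by
    refine ⟨1, fun i => i, by simp, by simp, fun i hi => ?_⟩
    obtain rfl : i = 0 := by omega
    refine ⟨by simp, fun t _ => ⟨fun s => v + s • x, by fun_prop, ?_, ?_⟩⟩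
    · filter_upwards [self_mem_nhdsWithin] with r hr
      have hr' : r ∈ Icc (0 : ℝ) 1 := by simpa using hr
      rw [Path.extend_apply _ hr']
      rfl
    · have : HasDerivAt (fun s : ℝ => v + s • x) ((1 : ℝ) • x) t :=
        ((hasDerivAt_id t).smul_const x).const_add v
      rw [this.deriv, one_smul]
      exact hmem
  exact hne (hc _ η hη ⟨s, hs⟩)

/-- In a causal manifold all displacements of nontrivial elements of `Γ` are spacelike. -/
theorem IsAdmissible.displacement_spacelike (hΓ : IsAdmissible ℓ (cone ℓ e) Γ)
    (hc : IsCausal (cone ℓ e) Γ) {γ : V ≃ᵃ[ℝ] V} (hγ : γ ∈ Γ) (hγ1 : γ ≠ 1) (v : V) :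
    ℓ (γ v - v) (γ v - v) < 0 := by
  by_contra! hnn
  rcases IsTimeOriented.mem_cone_or_neg_mem (e := e) hnn with h1 | h1
  · exact hΓ.displacement_notMem hc hγ hγ1 v h1
  · refine hΓ.displacement_notMem hc (Γ.inv_mem hγ) (inv_ne_one.mpr hγ1) (γ v) ?_
    have : γ⁻¹ (γ v) = v := γ.symm_apply_apply v
    rwa [this, ← neg_sub]

end Causality

/-! ### Topology of the cone and bounded orbits -/

section Topology

variable {V : Type*} [NormedAddCommGroup V] [NormedSpace ℝ V] [FiniteDimensional ℝ V]
variable {ℓ : LinearMap.BilinForm ℝ V} {e : V} {Γ : Subgroup (V ≃ᵃ[ℝ] V)}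

theorem continuous_form (ℓ : LinearMap.BilinForm ℝ V) :
    Continuous fun p : V × V => ℓ p.1 p.2 :=
  (LinearMap.toContinuousBilinearMap ℓ).continuous₂

theorem continuous_form_self (ℓ : LinearMap.BilinForm ℝ V) : Continuous fun v => ℓ v v :=
  (continuous_form ℓ).comp (continuous_id.prodMk continuous_id)

theorem continuous_form_left (ℓ : LinearMap.BilinForm ℝ V) (u : V) : Continuous fun v => ℓ u v :=
  (ℓ u).continuous_of_finiteDimensional

theorem isClosed_cone (ℓ : LinearMap.BilinForm ℝ V) (e : V) : IsClosed (cone ℓ e) :=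
  (isClosed_le continuous_const (continuous_form_self ℓ)).inter
    (isClosed_le continuous_const (continuous_form_left ℓ e))

namespace IsTimeOriented

variable (h : IsTimeOriented ℓ e)
include h

theorem mem_interior_cone {v : V} (hv : v ∈ cone ℓ e) (hpos : 0 < ℓ v v) :
    v ∈ interior (cone ℓ e) := by
  have hv0 : v ≠ 0 := by
    rintro rfl
    simp at hpos
  rw [mem_interior]
  exact ⟨{v | 0 < ℓ v v} ∩ {v | 0 < ℓ e v}, fun x hx => ⟨hx.1.le, hx.2.le⟩,
    (isOpen_lt continuous_const (continuous_form_self ℓ)).inter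
      (isOpen_lt continuous_const (continuous_form_left ℓ e)), hpos, h.time_pos hv hv0⟩

theorem form_self_of_mem_frontier {v : V} (hv : v ∈ frontier (cone ℓ e)) : ℓ v v = 0 := by
  rw [(isClosed_cone ℓ e).frontier_eq] at hv
  by_contra h0
  exact hv.2 (h.mem_interior_cone hv.1 (lt_of_le_of_ne hv.1.1 (Ne.symm h0)))

/-- Pairing with a timelike vector of the cone bounds the norm on the cone. -/
theorem exists_norm_le {q : V} (hq : q ∈ cone ℓ e) (hq' : 0 < ℓ q q) :
    ∃ m > 0, ∀ x ∈ cone ℓ e, m * ‖x‖ ≤ ℓ q x := by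
  have hK : IsCompact (cone ℓ e ∩ Metric.sphere 0 1) :=
    (isCompact_sphere 0 1).inter_left (isClosed_cone ℓ e)
  obtain ⟨m, hm, hmK⟩ := hK.exists_forall_le' (continuous_form_left ℓ q).continuousOn (a := 0)
    fun x hx => h.cone_pos hq hq' hx.1 (ne_zero_of_mem_unit_sphere ⟨x, hx.2⟩)
  refine ⟨m, hm, fun x hx => ?_⟩
  rcases eq_or_ne x 0 with rfl | hx0
  · simp
  have hn : 0 < ‖x‖ := norm_pos_iff.mpr hx0
  have h1 := hmK (‖x‖⁻¹ • x) ⟨smul_mem_cone hx (by positivity), by simp [norm_smul, hn.ne']⟩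
  rw [map_smul, smul_eq_mul, inv_mul_eq_div, le_div_iff₀ hn] at h1
  exact h1

/-- A timelike vector of the cone whose orbit under the linear parts is bounded yields a fixed
vector in the interior of the cone. -/
theorem isElliptic_of_bounded_orbit (hΓ : IsAdmissible ℓ (cone ℓ e) Γ) {x : V}
    (hx : x ∈ cone ℓ e) (hx' : 0 < ℓ x x) (r : ℝ) (hb : ∀ γ ∈ Γ, ‖γ.linear x‖ ≤ r) :
    IsElliptic (cone ℓ e) Γ := by
  set O : Set V := {y | ∃ γ ∈ Γ, γ.linear x = y} with hO
  set K := closure (convexHull ℝ O) with hKdef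
  have hxO : x ∈ O := ⟨1, Γ.one_mem, rfl⟩
  have hxK : x ∈ K := subset_closure (subset_convexHull ℝ O hxO)
  have hOb : Bornology.IsBounded O := by
    rw [isBounded_iff_forall_norm_le]
    refine ⟨r, ?_⟩
    rintro _ ⟨γ, hγ, rfl⟩
    exact hb γ hγ
  have hKc : IsCompact K :=
    Metric.isCompact_of_isClosed_isBounded isClosed_closure (isBounded_convexHull.mpr hOb).closure
  have hKC : K ⊆ cone ℓ e := by
    refine closure_minimal (convexHull_min ?_ h.convex_cone) (isClosed_cone ℓ e)
    rintro _ ⟨γ, hγ, rfl⟩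
    exact hΓ.linear_mem hγ hx
  have hKconv : Convex ℝ K := (convex_convexHull ℝ O).closure
  have hinv : ∀ γ ∈ Γ, ∀ y ∈ K, γ.linear y ∈ K := by
    intro γ hγ
    have hcont : Continuous γ.linear :=
      (γ.linear : V →ₗ[ℝ] V).continuous_of_finiteDimensional
    have hKO : convexHull ℝ O ⊆ (γ.linear : V →ₗ[ℝ] V) ⁻¹' convexHull ℝ O := by
      refine convexHull_min ?_ ((convex_convexHull ℝ O).linear_preimage _)
      rintro _ ⟨δ, hδ, rfl⟩
      exact subset_convexHull ℝ O ⟨γ * δ, Γ.mul_mem hγ hδ, rfl⟩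
    exact fun y hy => map_mem_closure hcont hy fun z hz => hKO hz
  obtain ⟨z, hzK, hz⟩ := hKc.exists_isMaxOn ⟨x, hxK⟩ (continuous_form_self ℓ).continuousOn
  have hzpos : 0 < ℓ z z := hx'.trans_le (hz hxK)
  refine ⟨z, h.mem_interior_cone (hKC hzK) hzpos, fun γ hγ => ?_⟩
  set y := γ.linear z with hy
  have hyK : y ∈ K := hinv γ hγ z hzK
  have hyy : ℓ y y = ℓ z z := hΓ.form_eq γ hγ z z
  -- Maximality at the midpoint makes `y - z` non-spacelike, yet it is orthogonal to the timelike `y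
  -- + z`; hence it vanishes.
  have hmid : ℓ ((1 / 2 : ℝ) • z + (1 / 2 : ℝ) • y) ((1 / 2 : ℝ) • z + (1 / 2 : ℝ) • y) ≤ ℓ z z :=
    hz (hKconv hzK hyK (by norm_num) (by norm_num) (by norm_num))
  have hyz := h.cone_nonneg (hKC hyK) (hKC hzK)
  simp only [map_add, map_smul, LinearMap.add_apply, LinearMap.smul_apply, smul_eq_mul,
    h.symm z y] at hmid
  refine sub_eq_zero.mp (h.eq_zero_of_orthogonal (u := y + z) ?_ ?_ ?_) <;>
    simp only [map_add, map_sub, LinearMap.add_apply, LinearMap.sub_apply, h.symm z y] <;>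
    linarith

end IsTimeOriented

end Topology

/-! ### Powers along an axis -/

section Axis

variable {V : Type*} [NormedAddCommGroup V] [NormedSpace ℝ V]

theorem pow_apply_axis {γ : V ≃ᵃ[ℝ] V} {o q : V} (ho : γ o = o + q) (hq : γ.linear q = q)
    (k : ℕ) (s : ℝ) : (γ ^ k) (o + s • q) = o + (s + k) • q := by
  have h1 : ∀ s : ℝ, γ (o + s • q) = o + (s + 1) • q := by
    intro s
    have := affineEquiv_apply_sub γ (o + s • q) o
    rw [add_sub_cancel_left, map_smul, hq, ho, sub_eq_iff_eq_add] at this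
    rw [this, add_smul, one_smul]
    abel
  induction k generalizing s with
  | zero => simp
  | succ k ih =>
    rw [pow_succ]
    show (γ ^ k) (γ (o + s • q)) = _
    rw [h1, ih]
    push_cast
    congr 2
    ring

theorem tendsto_clm_apply {S : ℕ → V →L[ℝ] V} {T : V →L[ℝ] V} {v : ℕ → V} {w : V}
    (hS : Tendsto S atTop (𝓝 T)) (hv : Tendsto v atTop (𝓝 w)) :
    Tendsto (fun n => S n (v n)) atTop (𝓝 (T w)) :=
  (isBoundedBilinearMap_apply.continuous.tendsto (T, w)).comp (hS.prodMk_nhds hv)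

end Axis

/-! ### A common fixed vector -/

section FixedVector

variable {V : Type*} [NormedAddCommGroup V] [NormedSpace ℝ V] [FiniteDimensional ℝ V]
variable {ℓ : LinearMap.BilinForm ℝ V} {e : V} {Γ : Subgroup (V ≃ᵃ[ℝ] V)}

namespace IsTimeOriented

variable (h : IsTimeOriented ℓ e)
include h

theorem exists_linear_fixed (hΓ : IsAdmissible ℓ (cone ℓ e) Γ) (hc : IsCausal (cone ℓ e) Γ)
    {γ : V ≃ᵃ[ℝ] V} (hγ : γ ∈ Γ) : ∃ w ∈ cone ℓ e, w ≠ 0 ∧ γ.linear w = w := by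
  by_cases hγ1 : γ = 1
  · exact ⟨e, h.self_mem_cone, h.ne_zero, by rw [hγ1]; rfl⟩
  · refine h.exists_fixed_mem_cone γ.linear (hΓ.form_eq γ hγ) (γ 0) fun v => ?_
    rw [← affineEquiv_apply_sub_self]
    exact hΓ.displacement_spacelike hc hγ hγ1 v

omit h in
/-- A limit of linear parts, rescaled by factors tending to zero, kills a nonzero vector of the
cone to which its image is orthogonal. -/
theorem exists_mem_ker_of_tendsto (hΓ : IsAdmissible ℓ (cone ℓ e) Γ)
    (hfix : ∀ γ ∈ Γ, ∃ w ∈ cone ℓ e, w ≠ 0 ∧ γ.linear w = w)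
    {γ : ℕ → V ≃ᵃ[ℝ] V} (hγ : ∀ n, γ n ∈ Γ) {c : ℕ → ℝ} (hc : Tendsto c atTop (𝓝 0))
    {S : ℕ → V →L[ℝ] V} {T : V →L[ℝ] V} (hS : Tendsto S atTop (𝓝 T))
    (hSγ : ∀ n v, S n v = c n • (γ n).linear v) :
    ∃ w ∈ cone ℓ e, w ≠ 0 ∧ T w = 0 ∧ ∀ u, ℓ (T u) w = 0 := by
  have hw : ∀ n, ∃ w ∈ cone ℓ e ∩ Metric.sphere (0 : V) 1, (γ n).linear w = w := by
    intro n
    obtain ⟨w, hw, hw0, hwf⟩ := hfix (γ n) (hγ n)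
    have hn : ‖w‖ ≠ 0 := norm_ne_zero_iff.mpr hw0
    exact ⟨‖w‖⁻¹ • w, ⟨smul_mem_cone hw (by positivity), by simp [norm_smul, hn]⟩, by
      rw [map_smul, hwf]⟩
  choose w hwK hwf using hw
  have hK : IsCompact (cone ℓ e ∩ Metric.sphere (0 : V) 1) :=
    (isCompact_sphere 0 1).inter_left (isClosed_cone ℓ e)
  obtain ⟨w', hw', φ, hφ, hlim⟩ := hK.tendsto_subseq hwK
  have hcφ := hc.comp hφ.tendsto_atTop
  have hSφ := hS.comp hφ.tendsto_atTop
  refine ⟨w', hw'.1, ne_zero_of_mem_unit_sphere ⟨w', hw'.2⟩, ?_, fun u => ?_⟩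
  · refine tendsto_nhds_unique (tendsto_clm_apply hSφ hlim) ?_
    have := hcφ.smul hlim
    rw [zero_smul] at this
    refine this.congr fun n => ?_
    simp only [Function.comp_apply, hSγ, hwf]
  · have h1 := ((continuous_form ℓ).tendsto (T u, w')).comp
      ((tendsto_clm_apply hSφ (tendsto_const_nhds (x := u))).prodMk_nhds hlim)
    refine tendsto_nhds_unique h1 ?_
    have h2 := hcφ.mul (((continuous_form_left ℓ u).tendsto w').comp hlim)
    rw [zero_mul] at h2
    refine h2.congr fun n => ?_
    simp only [Function.comp_apply, hSγ, map_smul, LinearMap.smul_apply, smul_eq_mul]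
    nth_rw 2 [← hwf (φ n)]
    rw [hΓ.form_eq _ (hγ _)]

/-- A nonzero linear map that keeps the cone kills no timelike vector of the cone. -/
theorem map_ne_zero_of_timelike {T : V →L[ℝ] V} (hT : ∀ x ∈ cone ℓ e, T x ∈ cone ℓ e)
    (hT0 : T ≠ 0) {y : V} (hy : y ∈ cone ℓ e) (hy' : 0 < ℓ y y) : T y ≠ 0 := by
  intro hTy
  apply hT0
  ext v
  have hcont : Continuous fun t : ℝ => y + t • v := by fun_prop
  have hnhds : cone ℓ e ∈ 𝓝 (y + (0 : ℝ) • v) := by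
    rw [zero_smul, add_zero]
    exact mem_interior_iff_mem_nhds.mp (h.mem_interior_cone hy hy')
  -- For small `t` both `y ± t • v` lie in the cone, so `± t • T v` do too, and the cone contains no
  -- line.
  obtain ⟨ε, hε, hball⟩ := Metric.mem_nhds_iff.mp (hcont.continuousAt.preimage_mem_nhds hnhds)
  have hmem : ∀ t : ℝ, |t| < ε → t • T v ∈ cone ℓ e := by
    intro t ht
    have h1 : y + t • v ∈ cone ℓ e := hball (by simpa using ht)
    have h2 := hT _ h1
    rwa [map_add, hTy, zero_add, map_smul] at h2
  have hp := hmem (ε / 2) (by rw [abs_of_pos (by positivity)]; linarith)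
  have hn := hmem (-(ε / 2)) (by rw [abs_neg, abs_of_pos (by positivity)]; linarith)
  rw [neg_smul] at hn
  exact (smul_eq_zero.mp (h.eq_zero_of_neg_mem hp hn)).resolve_left (by positivity)

/-- If the orbit of `e` under the linear parts is unbounded and each linear part fixes a nonzero
vector of the cone, then they fix such a vector simultaneously. -/
theorem exists_isFixed_of_unbounded (hΓ : IsAdmissible ℓ (cone ℓ e) Γ)
    (hfix : ∀ γ ∈ Γ, ∃ w ∈ cone ℓ e, w ≠ 0 ∧ γ.linear w = w)
    (hub : ∀ r : ℝ, ∃ γ ∈ Γ, r < ‖γ.linear e‖) :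
    ∃ x ∈ cone ℓ e, x ≠ 0 ∧ IsFixed Γ x := by
  choose γ hγ hγr using fun n : ℕ => hub n
  set A : ℕ → V →L[ℝ] V := fun n => LinearMap.toContinuousLinearMap ((γ n).linear : V →ₗ[ℝ] V)
  have hA : ∀ n v, A n v = (γ n).linear v := fun _ _ => rfl
  have hn : Tendsto (fun n => ‖A n‖) atTop atTop := by
    have h1 : Tendsto (fun n => ‖A n‖ * ‖e‖) atTop atTop :=
      tendsto_atTop_mono (fun n => (hγr n).le.trans ((A n).le_opNorm e))
        tendsto_natCast_atTop_atTop
    exact (tendsto_mul_const_atTop_of_pos (norm_pos_iff.mpr h.ne_zero)).mp h1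
  have hAn : ∀ n, ‖A n‖ ≠ 0 := by
    intro n h0
    have h1 := (A n).le_opNorm e
    rw [h0, zero_mul, hA] at h1
    exact absurd (h1.trans (Nat.cast_nonneg n)) (not_le.mpr (hγr n))
  obtain ⟨T, hT, φ, hφ, hlim⟩ := (isCompact_sphere (0 : V →L[ℝ] V) 1).tendsto_subseq
    (x := fun n => ‖A n‖⁻¹ • A n) fun n => by simp [norm_smul, hAn]
  have hT0 : T ≠ 0 := ne_zero_of_mem_unit_sphere ⟨T, hT⟩
  have hc : Tendsto (fun n => ‖A (φ n)‖⁻¹) atTop (𝓝 0) :=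
    (hn.comp hφ.tendsto_atTop).inv_tendsto_atTop
  have happ : ∀ v, Tendsto (fun n => ‖A (φ n)‖⁻¹ • (γ (φ n)).linear v) atTop (𝓝 (T v)) :=
    fun v => tendsto_clm_apply hlim (tendsto_const_nhds (x := v))
  have hTC : ∀ x ∈ cone ℓ e, T x ∈ cone ℓ e := fun x hx =>
    (isClosed_cone ℓ e).mem_of_tendsto (happ x) (Eventually.of_forall fun n =>
      smul_mem_cone (hΓ.linear_mem (hγ _) hx) (by positivity))
  have hTT : ∀ u, ℓ (T u) (T u) = 0 := by
    intro u
    refine tendsto_nhds_unique (((continuous_form_self ℓ).tendsto (T u)).comp (happ u)) ?_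
    have h1 := (hc.mul hc).mul_const (ℓ u u)
    rw [zero_mul, zero_mul] at h1
    refine h1.congr fun n => ?_
    simp only [Function.comp_apply, map_smul, LinearMap.smul_apply, smul_eq_mul,
      hΓ.form_eq _ (hγ _)]
    ring
  have hTe0 := h.map_ne_zero_of_timelike hTC hT0 h.self_mem_cone h.pos
  set x := T e with hx
  have hxC : x ∈ cone ℓ e := hTC e h.self_mem_cone
  -- The rescaled `δ * γ (φ n)` tend to `D.comp T`. The limit `w` of their fixed vectors is killed
  -- by `T` and orthogonal to `δ.linear x`, hence parallel to it.
  have hker : ∀ δ ∈ Γ, T (δ.linear x) = 0 := by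
    intro δ hδ
    set D : V →L[ℝ] V := LinearMap.toContinuousLinearMap (δ.linear : V →ₗ[ℝ] V)
    have hD : ∀ v, D v = δ.linear v := fun _ => rfl
    obtain ⟨w, hw, hw0, hTw, hort⟩ := exists_mem_ker_of_tendsto hΓ hfix
      (γ := fun n => δ * γ (φ n)) (fun n => Γ.mul_mem hδ (hγ _)) hc
      (S := fun n => D.comp (‖A (φ n)‖⁻¹ • A (φ n))) (T := D.comp T)
      (((ContinuousLinearMap.compL ℝ V V V D).continuous.tendsto T).comp hlim)
      (fun n v => by
        rw [ContinuousLinearMap.comp_apply, _root_.smul_apply, map_smul, hD, hA]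
        rfl)
    rw [ContinuousLinearMap.comp_apply, hD, LinearEquiv.map_eq_zero_iff] at hTw
    have h1 := h.smul_eq_of_orthogonal (hΓ.linear_mem hδ hxC) hw (hort e)
    have h2 := congrArg T h1
    rw [map_smul, map_smul, hTw, smul_zero] at h2
    exact (smul_eq_zero.mp h2).resolve_left (h.time_pos hw hw0).ne'
  refine ⟨x, hxC, hTe0, fun δ hδ => ?_⟩
  have hδC := hΓ.linear_mem hδ hxC
  have hTx : T x = 0 := hker 1 Γ.one_mem
  have hxx : ℓ x x = 0 := hTT e
  -- Otherwise `x + δ.linear x` would be a timelike vector killed by `T`.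
  have hort : ℓ x (δ.linear x) = 0 := by
    by_contra hne
    have hpos := lt_of_le_of_ne (h.cone_nonneg hxC hδC) (Ne.symm hne)
    refine h.map_ne_zero_of_timelike hTC hT0 (h.add_mem_cone hxC hδC) ?_ ?_
    · have h1 := hΓ.form_eq δ hδ x x
      simp only [map_add, LinearMap.add_apply, h.symm (δ.linear x) x]
      linarith
    · rw [map_add, hTx, hker δ hδ, add_zero]
  have hpar := h.smul_eq_of_orthogonal hxC hδC hort
  have hex := h.time_pos hxC hTe0
  obtain ⟨w, hw, hw0, hwδ⟩ := hfix δ hδ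
  have hscal : ℓ e (δ.linear x) * ℓ x w = ℓ e x * ℓ x w := by
    have h1 := congrArg (fun y => ℓ y w) hpar
    simp only [map_smul, LinearMap.smul_apply, smul_eq_mul] at h1
    have h2 := hΓ.form_eq δ hδ x w
    rw [hwδ] at h2
    rw [h1, h2]
  -- If `x` is orthogonal to the fixed `w`, it is parallel to `w`; otherwise pairing with `w` forces
  -- the scaling factor to be 1.
  by_cases hxw : ℓ x w = 0
  · have h1 := h.smul_eq_of_orthogonal hxC hw hxw
    have h2 := congrArg δ.linear h1
    rw [map_smul, map_smul, hwδ, ← h1] at h2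
    exact smul_right_injective V (h.time_pos hw hw0).ne' h2
  · rw [mul_right_cancel₀ hxw hscal] at hpar
    exact (smul_right_injective V hex.ne' hpar).symm

theorem exists_isFixed (hΓ : IsAdmissible ℓ (cone ℓ e) Γ) (hc : IsCausal (cone ℓ e) Γ)
    (hne : ¬ IsElliptic (cone ℓ e) Γ) : ∃ x ∈ cone ℓ e, x ≠ 0 ∧ IsFixed Γ x := by
  refine h.exists_isFixed_of_unbounded hΓ (fun γ hγ => h.exists_linear_fixed hΓ hc hγ) fun r => ?_
  by_contra! hr
  exact hne (h.isElliptic_of_bounded_orbit hΓ h.self_mem_cone h.pos r hr)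

end IsTimeOriented

end FixedVector

/-! ### Translation parts -/

section Translations

variable {V : Type*} [NormedAddCommGroup V] [NormedSpace ℝ V] [FiniteDimensional ℝ V]
variable {ℓ : LinearMap.BilinForm ℝ V} {e : V} {Γ : Subgroup (V ≃ᵃ[ℝ] V)}

namespace IsTimeOriented

variable (h : IsTimeOriented ℓ e)
include h

/-- A vector that is not orthogonal to the isotropic fixed vector `v₀` has images under the linear
parts with arbitrarily large products, unless `Γ` is elliptic. -/
theorem exists_lt_form_linear (hΓ : IsAdmissible ℓ (cone ℓ e) Γ)
    (hne : ¬ IsElliptic (cone ℓ e) Γ) {v₀ : V} (hv₀ : ℓ v₀ v₀ = 0) (hfix : IsFixed Γ v₀)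
    {q : V} (hq : ℓ q v₀ ≠ 0) (K : ℝ) : ∃ γ ∈ Γ, K < ℓ q (γ.linear q) := by
  by_contra! hK
  -- Chosen so that `q + t • v₀` has square 1. Adding the fixed isotropic vector shifts every
  -- product with an image by the same constant, so a bound for `q` would bound a timelike orbit.
  set t := (1 - ℓ q q) / (2 * ℓ q v₀) with ht
  have ht' : 2 * t * ℓ q v₀ = 1 - ℓ q q := by
    rw [ht]
    field_simp
  have hval : ∀ γ ∈ Γ, ℓ (q + t • v₀) (γ.linear (q + t • v₀)) =
      ℓ q (γ.linear q) + (1 - ℓ q q) := by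
    intro γ hγ
    have h1 : ℓ v₀ (γ.linear q) = ℓ q v₀ := by
      nth_rw 1 [← hfix γ hγ]
      rw [hΓ.form_eq γ hγ, h.symm]
    rw [← ht']
    simp only [map_add, map_smul, LinearMap.add_apply, LinearMap.smul_apply, smul_eq_mul,
      hfix γ hγ, h1, hv₀]
    ring
  obtain ⟨p, hp, hpp, hpγ⟩ : ∃ p ∈ cone ℓ e, ℓ p p = 1 ∧
      ∀ γ ∈ Γ, ℓ p (γ.linear p) = ℓ q (γ.linear q) + (1 - ℓ q q) := by
    have h1 : ℓ (q + t • v₀) (q + t • v₀) = 1 := by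
      have := hval 1 Γ.one_mem
      have h2 : ∀ v, (1 : V ≃ᵃ[ℝ] V).linear v = v := fun _ => rfl
      rw [h2, h2] at this
      linarith
    rcases mem_cone_or_neg_mem (ℓ := ℓ) (e := e) (x := q + t • v₀) (by rw [h1]; norm_num)
      with h2 | h2
    · exact ⟨_, h2, h1, hval⟩
    · refine ⟨_, h2, ?_, fun γ hγ => ?_⟩
      · rw [← h1]
        simp only [map_neg, LinearMap.neg_apply, neg_neg]
      · rw [← hval γ hγ]
        simp only [map_neg, LinearMap.neg_apply, neg_neg]
  obtain ⟨m, hm, hmle⟩ := h.exists_norm_le hp (by rw [hpp]; norm_num)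
  refine hne (h.isElliptic_of_bounded_orbit hΓ hp (by rw [hpp]; norm_num)
    ((K + (1 - ℓ q q)) / m) fun γ hγ => ?_)
  rw [le_div_iff₀ hm, mul_comm]
  refine (hmle _ (hΓ.linear_mem hγ hp)).trans ?_
  rw [hpγ γ hγ]
  linarith [hK γ hγ]

theorem form_trans_eq_zero (hΓ : IsAdmissible ℓ (cone ℓ e) Γ) (hc : IsCausal (cone ℓ e) Γ)
    (hne : ¬ IsElliptic (cone ℓ e) Γ) {v₀ : V} (hv₀ : ℓ v₀ v₀ = 0) (hfix : IsFixed Γ v₀)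
    {γ : V ≃ᵃ[ℝ] V} (hγ : γ ∈ Γ) : ℓ v₀ (γ 0) = 0 := by
  by_contra hτ
  have hγ1 : γ ≠ 1 := by
    rintro rfl
    exact hτ (map_zero (ℓ v₀))
  obtain ⟨o, ho⟩ := h.exists_axis γ.linear (hΓ.form_eq γ hγ) (γ 0) fun v => by
    rw [← affineEquiv_apply_sub_self]
    exact hΓ.displacement_spacelike hc hγ hγ1 v
  rw [← affineEquiv_apply_sub_self] at ho
  set q := γ o - o with hq
  have hoq : γ o = o + q := (add_sub_cancel _ _).symm
  have hqv : ℓ q v₀ ≠ 0 := by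
    have h1 : ℓ v₀ (γ.linear o) = ℓ v₀ o := by
      nth_rw 1 [← hfix γ hγ]
      rw [hΓ.form_eq γ hγ]
    rwa [hq, affineEquiv_apply_sub_self, h.symm, map_add, map_sub, h1, sub_self, add_zero]
  -- The bound `-ℓ q q` is exactly what makes `δ.linear q + q` timelike.
  obtain ⟨δ, hδ, hlt⟩ := h.exists_lt_form_linear hΓ hne hv₀ hfix hqv (-ℓ q q)
  set y := δ.linear q + q with hy
  have hypos : 0 < ℓ y y := by
    have h1 := hΓ.form_eq δ hδ q q
    simp only [hy, map_add, LinearMap.add_apply, h.symm (δ.linear q) q]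
    linarith
  obtain ⟨k, hk⟩ := exists_nat_form_add_smul_pos h.symm (δ o - o) hypos
  -- Write the subtracted `o` as the image under `γ ^ k` of `o - k • q`; the inner `γ ^ k` sends `o`
  -- to `o + k • q`.
  have hdisp : (γ ^ k * δ * γ ^ k) o - o = (γ ^ k).linear (δ o - o + (k : ℝ) • y) := by
    have h1 := pow_apply_axis hoq ho k 0
    have h2 := pow_apply_axis hoq ho k (-k)
    rw [zero_smul, add_zero, zero_add] at h1
    rw [neg_add_cancel, zero_smul, add_zero] at h2
    have h3 : (γ ^ k * δ * γ ^ k) o = (γ ^ k) (δ ((γ ^ k) o)) := rfl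
    have h4 := affineEquiv_apply_sub δ (o + (k : ℝ) • q) o
    rw [add_sub_cancel_left, map_smul, sub_eq_iff_eq_add] at h4
    nth_rw 2 [← h2]
    rw [h3, h1, affineEquiv_apply_sub, h4, hy, smul_add, neg_smul]
    congr 1
    abel
  have hmem : γ ^ k ∈ Γ := Γ.pow_mem hγ k
  have hpos : 0 < ℓ ((γ ^ k * δ * γ ^ k) o - o) ((γ ^ k * δ * γ ^ k) o - o) := by
    rwa [hdisp, hΓ.form_eq _ hmem]
  have hne1 : γ ^ k * δ * γ ^ k ≠ 1 := by
    intro h1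
    rw [h1] at hpos
    have h2 : (1 : V ≃ᵃ[ℝ] V) o = o := rfl
    rw [h2, sub_self] at hpos
    simp at hpos
  exact absurd (hΓ.displacement_spacelike hc (Γ.mul_mem (Γ.mul_mem hmem hδ) hmem) hne1 o)
    (not_lt.mpr hpos.le)

end IsTimeOriented

end Translations

end FlatLorentz

theorem mainTheorem5 {V : Type*} [NormedAddCommGroup V] [NormedSpace ℝ V] [FiniteDimensional ℝ V]
    (ℓ : LinearMap.BilinForm ℝ V) (hℓ : FlatLorentz.IsLorentzian ℓ)
    (e : V) (he : 0 < ℓ e e)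
    (Γ : Subgroup (V ≃ᵃ[ℝ] V))
    (hΓ : FlatLorentz.IsAdmissible ℓ (FlatLorentz.cone ℓ e) Γ)
    (hM : FlatLorentz.IsStrictlyCausal (FlatLorentz.cone ℓ e) Γ)
    (hne : ¬ FlatLorentz.IsElliptic (FlatLorentz.cone ℓ e) Γ) :
    (∃ v₀ ∈ frontier (FlatLorentz.cone ℓ e), v₀ ≠ 0 ∧ FlatLorentz.IsFixed Γ v₀) ∧
    ∀ v₀ ∈ frontier (FlatLorentz.cone ℓ e), v₀ ≠ 0 → FlatLorentz.IsFixed Γ v₀ →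
      ∀ γ ∈ Γ, FlatLorentz.trans γ ∈ FlatLorentz.perp ℓ v₀ := by
  have h := hℓ.isTimeOriented he
  refine ⟨?_, fun v₀ hv₀ _ hfix γ hγ => ?_⟩
  · obtain ⟨x, hx, hx0, hfix⟩ := h.exists_isFixed hΓ hM.1 hne
    refine ⟨x, ?_, hx0, hfix⟩
    rw [(FlatLorentz.isClosed_cone ℓ e).frontier_eq]
    exact ⟨hx, fun hint => hne ⟨x, hint, hfix⟩⟩
  · have h0 := h.form_trans_eq_zero hΓ hM.1 hne (h.form_self_of_mem_frontier hv₀) hfix hγ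
    refine LinearMap.BilinForm.mem_orthogonal_iff.mpr fun y hy => ?_
    obtain ⟨t, rfl⟩ := Submodule.mem_span_singleton.mp hy
    show ℓ (t • v₀) (γ 0) = 0
    rw [map_smul, LinearMap.smul_apply, h0, smul_zero]
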